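/- Conventions. An mm-space is a complete separable metric space $(X,d_X)$ together with a Borel probability measure $m_X$ on $X$. Its 1-measurement $\mathcal M(X;1)$ is the set of the push-forwards $f_*m_X$, where $f:X\to\mathbb R$ runs over the 1-Lipschitz functions. For $S\subset\mathbb R^2$ let $$\operatorname{dev}_\succ S:=\sup\{\,y-y'-\max\{x-x',0\}\mid (x,y),(x',y')\in S\,\}.$$ For Borel probability measures $\mu,\nu$ on $\mathbb R$ and $s,t\ge 0$, write $\mu\succ'_{(s,t)}\nu$ if there are a Borel probability measure $\pi$ on $\mathbb R^2$ with marginals $\mu$ (first) and $\nu$ (second) and a Borel set $S\subset\mathbb R^2$ with $\operatorname{dev}_\succ S\le s$ and $1-\pi(S)\le t$. For $\varepsilon\ge 0$, a Borel probability measure $\nu$ on $\mathbb R$ is an $\varepsilon$-iso-dominant of an mm-space $X$ if $\nu\succ'_{(\varepsilon,0)}\mu$ for all $\mu\in\mathcal M(X;1)$. Let $I:=[0,1)$ with the Lebesgue measure $\mathcal L^1$. A parameter of $X$ is a Borel map $\varphi:I\to X$ with $\varphi_*\mathcal L^1=m_X$, and $\varphi^*\mathrm{Lip}_1(X):=\{f\circ\varphi\mid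 f:X\to\mathbb R \text{ is 1-Lipschitz}\}$. The observable distance is $$d_{\mathrm{conc}}(X,Y):=\inf_{\varphi,\psi} d_H^{KF}\big(\varphi^*\mathrm{Lip}_1(X),\psi^*\mathrm{Lip}_1(Y)\big),$$ where $\varphi,\psi$ run over the parameters of $X$ and $Y$ respectively, and $d_H^{KF}$ is the Hausdorff distance with respect to the Ky Fan metric $d_{KF}(f,g):=\inf\{\varepsilon\ge0\mid \mathcal L^1(\{t\in I: |f(t)-g(t)|>\varepsilon\})\le\varepsilon\}$. **Theorem 1.6.** Let $X$ and $X_n$, $n=1,2,\dots$, be mm-spaces, $\nu$ and $\nu_n$, $n=1,2,\dots$, Borel probability measures on $\mathbb R$, and $\varepsilon_n$, $n=1,2,\dots$, non-negative real numbers. Assume that $d_{\mathrm{conc}}(X_n,X)\to0$, that $\nu_n$ converges weakly to $\nu$, that $\varepsilon_n$ converges to a real number $\varepsilon$ as $n\to\infty$, and that $\nu_n$ is an $\varepsilon_n$-iso-dominant of $X_n$ for every positive integer $n$. Then $\nu$ is an $\varepsilon$-iso-dominant of $X$. -/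

import Mathlib

open MeasureTheory Filter Topology Set
open scoped NNReal ENNReal

noncomputable section

namespace IsoDom

/-! An mm-space is a complete separable metric space `X` with its Borel σ-algebra and a Borel
probability measure `m` on `X`. It is given below by the type `X`, the usual type classes, and `m`. -/

/-- The half-open interval `[0, 1)`. -/
abbrev I : Type := Set.Ico (0 : ℝ) 1

/-- The one-dimensional Lebesgue measure `𝓛¹` on `[0, 1)`. -/
def leb : Measure I := Measure.comap ((↑) : I → ℝ) volume

/-- A parameter of `(X, m)`: a Borel map `φ : [0, 1) → X` pushing the Lebesgue measure to `m`. -/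
def IsParameter {X : Type*} [MeasurableSpace X] (m : Measure X) (φ : I → X) : Prop :=
  Measurable φ ∧ Measure.map φ leb = m

/-- The Ky Fan distance `inf {ε ≥ 0 | 𝓛¹ {t | |f t - g t| > ε} ≤ ε}` (it is at most one). -/
def kyFan (f g : I → ℝ) : ℝ≥0∞ :=
  ⨅ (ε : ℝ≥0) (_ : leb {t | (ε : ℝ) < |f t - g t|} ≤ (ε : ℝ≥0∞)), (ε : ℝ≥0∞)

/-- The Hausdorff distance between two sets of functions with respect to the Ky Fan distance. -/
def hausdorffKyFan (A B : Set (I → ℝ)) : ℝ≥0∞ :=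
  (⨆ f ∈ A, ⨅ g ∈ B, kyFan f g) ⊔ (⨆ g ∈ B, ⨅ f ∈ A, kyFan f g)

/-- The set `φ^* Lip₁(X) = {f ∘ φ | f : X → ℝ is 1-Lipschitz}`. -/
def pullbackLip {X : Type*} [PseudoMetricSpace X] (φ : I → X) : Set (I → ℝ) :=
  {h | ∃ f : X → ℝ, LipschitzWith 1 f ∧ h = f ∘ φ}

/-- The observable distance between `(X, mX)` and `(Y, mY)`: the infimum over all parameters
`φ` of `X` and `ψ` of `Y` of the Hausdorff distance between `φ^* Lip₁(X)` and `ψ^* Lip₁(Y)`. -/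
def dConc {X Y : Type*} [PseudoMetricSpace X] [MeasurableSpace X]
    [PseudoMetricSpace Y] [MeasurableSpace Y] (mX : Measure X) (mY : Measure Y) : ℝ≥0∞ :=
  ⨅ (φ : I → X) (_ : IsParameter mX φ) (ψ : I → Y) (_ : IsParameter mY ψ),
    hausdorffKyFan (pullbackLip φ) (pullbackLip ψ)

/-- The 1-measurement of `(X, m)`: all push-forwards of `m` by 1-Lipschitz functions `X → ℝ`. -/
def measurement {X : Type*} [PseudoMetricSpace X] [MeasurableSpace X] (m : Measure X) :
    Set (ProbabilityMeasure ℝ) :=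
  {μ | ∃ f : X → ℝ, LipschitzWith 1 f ∧ (μ : Measure ℝ) = Measure.map f m}

/-- The iso-deviation of `S ⊆ ℝ²`: the supremum in `[-∞, ∞]` of `y - y' - max (x - x') 0` over
`(x, y), (x', y') ∈ S`. -/
def isoDev (S : Set (ℝ × ℝ)) : EReal :=
  ⨆ p ∈ S, ⨆ q ∈ S, ((p.2 - q.2 - max (p.1 - q.1) 0 : ℝ) : EReal)

/-- `π` is a transport plan between `μ` and `ν`. -/
def IsTransportPlan (π : ProbabilityMeasure (ℝ × ℝ)) (μ ν : ProbabilityMeasure ℝ) : Prop :=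
  Measure.map Prod.fst (π : Measure (ℝ × ℝ)) = μ ∧ Measure.map Prod.snd (π : Measure (ℝ × ℝ)) = ν

/-- `μ` iso-dominates `ν` with error `(s, t)`. -/
def IsoDominates (s t : ℝ) (μ ν : ProbabilityMeasure ℝ) : Prop :=
  ∃ π : ProbabilityMeasure (ℝ × ℝ), IsTransportPlan π μ ν ∧
    ∃ S : Set (ℝ × ℝ), MeasurableSet S ∧ isoDev S ≤ (s : EReal) ∧
      1 - (π : Measure (ℝ × ℝ)).real S ≤ t

/-- `ν` is an `ε`-iso-dominant of `(X, m)`: it iso-dominates with error `(ε, 0)` every element of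
the 1-measurement of `(X, m)`. -/
def IsIsoDominant {X : Type*} [PseudoMetricSpace X] [MeasurableSpace X]
    (ε : ℝ) (ν : ProbabilityMeasure ℝ) (m : Measure X) : Prop :=
  ∀ μ ∈ measurement m, IsoDominates ε 0 ν μ

end IsoDom

end

/-!
Let `μ = f_* m` with `f` 1-Lipschitz on `X`. Since `dConc (mn n) m → 0`, there are 1-Lipschitz
functions `g n` on `Xn n` and parameters under which `g n` and `f` are close in the Ky Fan
distance; as the Ky Fan distance dominates the Lévy–Prokhorov distance of the laws
(`levyProkhorovEDist_map_le_kyFan`), the measures `(g n)_* (mn n)` converge weakly to `μ`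
(`exists_tendsto_of_mem_measurement`).

It remains to pass to the limit in the relation "iso-dominates with error `(ε, 0)`"
(`IsoDominates.of_tendsto`). The transport plans have weakly convergent marginals, so they are
tight and, by Prokhorov's theorem, have a cluster point `π`, which is a transport plan between the
limits. Every neighbourhood of a point of the support of `π` is eventually charged along the
ultrafilter, so it meets the sets carrying the plans: the bound on the iso-deviation passes to the
support of `π`, a closed set of full measure.
-/

namespace IsoDom

/-! ### Parameters, the Ky Fan distance and the Lévy–Prokhorov distance -/

instance isProbabilityMeasure_leb : IsProbabilityMeasure leb := by
  constructor
  rw [leb, (MeasurableEmbedding.subtype_coe measurableSet_Ico).comap_apply, image_univ,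
    Subtype.range_coe, Real.volume_Ico, sub_zero, ENNReal.ofReal_one]

lemma kyFan_comm (F G : I → ℝ) : kyFan F G = kyFan G F := by
  simp only [kyFan, abs_sub_comm]

/-- If `|F - G| ≤ ε` outside a set of measure at most `ε`, then `F ∈ B` forces `G` to be in the
`ε`-thickening of `B` outside that set. -/
lemma map_le_map_thickening_add {F G : I → ℝ} (hF : Measurable F) (hG : Measurable G)
    {ε : ℝ≥0∞} (hε : kyFan F G < ε) (hε' : ε < ∞) {B : Set ℝ} (hB : MeasurableSet B) :
    Measure.map F leb B ≤ Measure.map G leb (Metric.thickening ε.toReal B) + ε := by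
  simp only [kyFan, iInf_lt_iff] at hε
  obtain ⟨δ, hδ, hδε⟩ := hε
  rw [Measure.map_apply hF hB, Measure.map_apply hG Metric.isOpen_thickening.measurableSet]
  have hsub : F ⁻¹' B ⊆
      G ⁻¹' (Metric.thickening ε.toReal B) ∪ {t | (δ : ℝ) < |F t - G t|} := by
    intro t ht
    by_cases h : (δ : ℝ) < |F t - G t|
    · exact Or.inr h
    · refine Or.inl (Metric.mem_thickening_iff.2 ⟨F t, ht, ?_⟩)
      rw [dist_comm, Real.dist_eq]
      have : (δ : ℝ) < ε.toReal := (ENNReal.toReal_lt_toReal ENNReal.coe_ne_top hε'.ne).2 hδε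
      exact (not_lt.1 h).trans_lt this
  calc leb (F ⁻¹' B) ≤ _ := measure_mono hsub
    _ ≤ _ := measure_union_le _ _
    _ ≤ _ := by gcongr; exact hδ.trans hδε.le

/-- Convergence in probability controls convergence in law: the Ky Fan distance dominates the
Lévy–Prokhorov distance of the laws. -/
lemma levyProkhorovEDist_map_le_kyFan {F G : I → ℝ} (hF : Measurable F) (hG : Measurable G) :
    levyProkhorovEDist (Measure.map F leb) (Measure.map G leb) ≤ kyFan F G := by
  refine levyProkhorovEDist_le_of_forall _ _ _ fun ε B h h' hB =>
    ⟨map_le_map_thickening_add hF hG h h' hB, map_le_map_thickening_add hG hF ?_ h' hB⟩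
  rwa [kyFan_comm]

lemma map_comp_parameter {X : Type*} [PseudoMetricSpace X] [MeasurableSpace X] [BorelSpace X]
    {m : Measure X} {φ : I → X} (hφ : IsParameter m φ) {f : X → ℝ} (hf : LipschitzWith 1 f) :
    Measure.map (f ∘ φ) leb = Measure.map f m := by
  rw [← hφ.2, Measure.map_map hf.continuous.measurable hφ.1]

/-- If `X` and `Y` are at small observable distance, every law of a 1-Lipschitz function on `Y` is
close to the law of some 1-Lipschitz function on `X`. -/
lemma exists_levyProkhorovEDist_lt {X Y : Type*}
    [PseudoMetricSpace X] [MeasurableSpace X] [BorelSpace X]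
    [PseudoMetricSpace Y] [MeasurableSpace Y] [BorelSpace Y] {mX : Measure X} {mY : Measure Y}
    {δ : ℝ≥0∞} (h : dConc mX mY < δ) {f : Y → ℝ} (hf : LipschitzWith 1 f) :
    ∃ g : X → ℝ, LipschitzWith 1 g ∧
      levyProkhorovEDist (Measure.map g mX) (Measure.map f mY) < δ := by
  simp only [dConc, iInf_lt_iff] at h
  obtain ⟨φ, hφ, ψ, hψ, h⟩ := h
  have h₁ : ⨅ u ∈ pullbackLip φ, kyFan u (f ∘ ψ) < δ :=
    lt_of_le_of_lt ((le_iSup₂ (f := fun v (_ : v ∈ pullbackLip ψ) =>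
      ⨅ u ∈ pullbackLip φ, kyFan u v) (f ∘ ψ) ⟨f, hf, rfl⟩).trans le_sup_right) h
  simp only [iInf_lt_iff] at h₁
  obtain ⟨_, ⟨g, hg, rfl⟩, h₂⟩ := h₁
  refine ⟨g, hg, ?_⟩
  rw [← map_comp_parameter hφ hg, ← map_comp_parameter hψ hf]
  exact (levyProkhorovEDist_map_le_kyFan (hg.continuous.measurable.comp hφ.1)
    (hf.continuous.measurable.comp hψ.1)).trans_lt h₂

/-- Concentration implies that each element of the 1-measurement of the limit is a weak limit of
elements of the 1-measurements. -/
lemma exists_tendsto_of_mem_measurement {X : Type*} [PseudoMetricSpace X] [MeasurableSpace X]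
    [BorelSpace X] {m : Measure X} {Xn : ℕ → Type*} [∀ n, PseudoMetricSpace (Xn n)]
    [∀ n, MeasurableSpace (Xn n)] [∀ n, BorelSpace (Xn n)] {mn : ∀ n, Measure (Xn n)}
    [∀ n, IsProbabilityMeasure (mn n)]
    (hX : Tendsto (fun n => dConc (mn n) m) atTop (𝓝 0))
    {μ : ProbabilityMeasure ℝ} (hμ : μ ∈ measurement m) :
    ∃ μn : ℕ → ProbabilityMeasure ℝ, (∀ n, μn n ∈ measurement (mn n)) ∧
      Tendsto μn atTop (𝓝 μ) := by
  obtain ⟨f, hf, hμf⟩ := hμ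
  -- A function within `dConc + 1 / (n + 1)`: the Hausdorff infimum need not be attained. The
  -- case distinction provides a value for the finitely many `n` with `dConc = ∞`.
  have key : ∀ n, ∃ g : Xn n → ℝ, LipschitzWith 1 g ∧
      levyProkhorovEDist (Measure.map g (mn n)) (Measure.map f m)
        ≤ dConc (mn n) m + ((n : ℝ≥0∞) + 1)⁻¹ := by
    intro n
    by_cases htop : dConc (mn n) m = ∞
    · exact ⟨fun _ => 0, LipschitzWith.const' 0, by simp [htop]⟩
    · obtain ⟨g, hg, h⟩ := exists_levyProkhorovEDist_lt
        (ENNReal.lt_add_right htop (b := ((n : ℝ≥0∞) + 1)⁻¹) (by simp)) hf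
      exact ⟨g, hg, h.le⟩
  choose g hg hgf using key
  have hprob : ∀ n, IsProbabilityMeasure (Measure.map (g n) (mn n)) := fun n =>
    Measure.isProbabilityMeasure_map (hg n).continuous.measurable.aemeasurable
  let μn : ℕ → ProbabilityMeasure ℝ := fun n => ⟨Measure.map (g n) (mn n), hprob n⟩
  refine ⟨μn, fun n => ⟨g n, hg n, rfl⟩, ?_⟩
  have hinv : Tendsto (fun n : ℕ => ((n : ℝ≥0∞) + 1)⁻¹) atTop (𝓝 0) := by
    have := (tendsto_add_atTop_iff_nat 1).2 ENNReal.tendsto_inv_nat_nhds_zero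
    simpa using this
  have hLP : Tendsto (fun n => LevyProkhorov.ofMeasure (μn n)) atTop
      (𝓝 (LevyProkhorov.ofMeasure μ)) := by
    rw [tendsto_iff_edist_tendsto_0]
    refine tendsto_of_tendsto_of_tendsto_of_le_of_le tendsto_const_nhds
      (by simpa using hX.add hinv) (fun _ => zero_le) fun n => ?_
    simp only [LevyProkhorov.edist_probabilityMeasure_def, hμf]
    exact hgf n
  exact (LevyProkhorov.continuous_toMeasure_probabilityMeasure.tendsto _).comp hLP

/-! ### Weak limits of iso-domination -/

/-- A weakly convergent sequence of probability measures on a Polish metric space is tight. -/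
lemma isTightMeasureSet_range_of_tendsto {E : Type*} [MetricSpace E] [CompleteSpace E]
    [SecondCountableTopology E] [MeasurableSpace E] [BorelSpace E]
    {μn : ℕ → ProbabilityMeasure E} {μ : ProbabilityMeasure E} (h : Tendsto μn atTop (𝓝 μ)) :
    IsTightMeasureSet (range fun n => (μn n : Measure E)) := by
  have hK := h.isCompact_insert_range
  have := isTightMeasureSet_of_isCompact_closure (hK.isClosed.closure_eq.symm ▸ hK)
  refine this.subset ?_
  rintro _ ⟨n, rfl⟩
  exact ⟨μn n, mem_insert_of_mem _ ⟨n, rfl⟩, rfl⟩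

/-- The transport plans between two weakly convergent sequences have a weak limit, along some
ultrafilter, which is a transport plan between the limits. -/
lemma exists_tendsto_isTransportPlan {νn μn : ℕ → ProbabilityMeasure ℝ}
    {ν μ : ProbabilityMeasure ℝ} (hν : Tendsto νn atTop (𝓝 ν)) (hμ : Tendsto μn atTop (𝓝 μ))
    {πn : ℕ → ProbabilityMeasure (ℝ × ℝ)} (hπ : ∀ n, IsTransportPlan (πn n) (νn n) (μn n)) :
    ∃ (U : Ultrafilter ℕ) (π : ProbabilityMeasure (ℝ × ℝ)), (U : Filter ℕ) ≤ atTop ∧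
      Tendsto πn U (𝓝 π) ∧ IsTransportPlan π ν μ := by
  have htight : IsTightMeasureSet {((ρ : ProbabilityMeasure (ℝ × ℝ)) : Measure (ℝ × ℝ)) |
      ρ ∈ range πn} := by
    refine IsTightMeasureSet.prodMk ((isTightMeasureSet_range_of_tendsto hν).subset ?_)
      ((isTightMeasureSet_range_of_tendsto hμ).subset ?_)
    · rintro _ ⟨_, ⟨_, ⟨n, rfl⟩, rfl⟩, rfl⟩
      exact ⟨n, (hπ n).1.symm⟩
    · rintro _ ⟨_, ⟨_, ⟨n, rfl⟩, rfl⟩, rfl⟩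
      exact ⟨n, (hπ n).2.symm⟩
  let U : Ultrafilter ℕ := Ultrafilter.of atTop
  have hU : (U : Filter ℕ) ≤ atTop := Ultrafilter.of_le _
  obtain ⟨π, -, hlim⟩ := (isCompact_closure_of_isTightMeasureSet htight).ultrafilter_le_nhds
    (U.map πn) (le_principal_iff.2 (Filter.mem_map.2
      (Eventually.of_forall fun n => subset_closure ⟨n, rfl⟩)))
  have hlim : Tendsto πn U (𝓝 π) := hlim
  refine ⟨U, π, hU, hlim, ?_, ?_⟩
  · have h₁ := ProbabilityMeasure.tendsto_map_of_tendsto_of_continuous πn π hlim continuous_fst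
    have h₂ : (fun n => (πn n).map (continuous_fst (X := ℝ) (Y := ℝ)).measurable.aemeasurable)
        = νn := funext fun n => ProbabilityMeasure.toMeasure_injective (hπ n).1
    rw [h₂] at h₁
    exact congrArg ProbabilityMeasure.toMeasure (tendsto_nhds_unique h₁ (hν.mono_left hU))
  · have h₁ := ProbabilityMeasure.tendsto_map_of_tendsto_of_continuous πn π hlim continuous_snd
    have h₂ : (fun n => (πn n).map (continuous_snd (X := ℝ) (Y := ℝ)).measurable.aemeasurable)
        = μn := funext fun n => ProbabilityMeasure.toMeasure_injective (hπ n).2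
    rw [h₂] at h₁
    exact congrArg ProbabilityMeasure.toMeasure (tendsto_nhds_unique h₁ (hμ.mono_left hU))

/-- Sets of full measure for `πn` eventually meet every neighbourhood of a point in the support of
the weak limit. -/
lemma eventually_inter_nonempty_of_mem_support {E ι : Type*} [MetricSpace E] [MeasurableSpace E]
    [BorelSpace E] {L : Filter ι} {πn : ι → ProbabilityMeasure E} {π : ProbabilityMeasure E}
    (hlim : Tendsto πn L (𝓝 π)) {Sn : ι → Set E} (hS : ∀ i, (πn i : Measure E) (Sn i)ᶜ = 0)
    {p : E} (hp : p ∈ (π : Measure E).support) {V : Set E} (hV : V ∈ 𝓝 p) :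
    ∀ᶠ i in L, (V ∩ Sn i).Nonempty := by
  obtain ⟨W, hWV, hW, hpW⟩ := mem_nhds_iff.1 hV
  have hpos : 0 < L.liminf fun i => (πn i : Measure E) W :=
    ((Measure.mem_support_iff_forall p).1 hp W (hW.mem_nhds hpW)).trans_le
      (ProbabilityMeasure.le_liminf_measure_open_of_tendsto hlim hW)
  filter_upwards [eventually_lt_of_lt_liminf hpos] with i hi
  by_contra hne
  have hsub : W ⊆ (Sn i)ᶜ := fun x hx hxS => hne ⟨x, hWV hx, hxS⟩
  exact hi.ne' (measure_mono_null hsub (hS i))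

lemma isoDev_le_iff {S : Set (ℝ × ℝ)} {s : ℝ} :
    isoDev S ≤ (s : EReal) ↔ ∀ p ∈ S, ∀ q ∈ S, p.2 - q.2 - max (p.1 - q.1) 0 ≤ s := by
  simp only [isoDev, iSup_le_iff, EReal.coe_le_coe_iff]

/-- Iso-domination with error `(ε, 0)` is closed under weak convergence of both measures and
convergence of `ε`. -/
lemma IsoDominates.of_tendsto {νn μn : ℕ → ProbabilityMeasure ℝ} {ν μ : ProbabilityMeasure ℝ}
    {εn : ℕ → ℝ} {ε : ℝ} (hν : Tendsto νn atTop (𝓝 ν)) (hμ : Tendsto μn atTop (𝓝 μ))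
    (hε : Tendsto εn atTop (𝓝 ε)) (h : ∀ n, IsoDominates (εn n) 0 (νn n) (μn n)) :
    IsoDominates ε 0 ν μ := by
  choose πn hπn Sn hSmeas hSdev hSfull using h
  obtain ⟨U, π, hU, hlim, hπ⟩ := exists_tendsto_isTransportPlan hν hμ hπn
  have hnull : ∀ n, (πn n : Measure (ℝ × ℝ)) (Sn n)ᶜ = 0 := fun n => by
    have h₁ := probReal_compl_eq_one_sub (μ := (πn n : Measure (ℝ × ℝ))) (hSmeas n)
    rw [← measureReal_eq_zero_iff]
    exact le_antisymm (h₁.trans_le (hSfull n)) measureReal_nonneg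
  refine ⟨π, hπ, (π : Measure (ℝ × ℝ)).support, Measure.isClosed_support.measurableSet, ?_, ?_⟩
  · refine isoDev_le_iff.2 fun p hp q hq => le_of_forall_pos_le_add fun η hη => ?_
    let D : (ℝ × ℝ) × (ℝ × ℝ) → ℝ := fun z => z.1.2 - z.2.2 - max (z.1.1 - z.2.1) 0
    have hD : Continuous D := by fun_prop
    have hmem : {z | D (p, q) - η / 2 < D z} ∈ 𝓝 (p, q) :=
      (isOpen_lt continuous_const hD).mem_nhds (by simp [hη])
    obtain ⟨V, hV, W, hW, hVW⟩ := mem_nhds_prod_iff.1 hmem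
    obtain ⟨n, ⟨x, hxV, hxS⟩, ⟨y, hyW, hyS⟩, hn⟩ :=
      ((eventually_inter_nonempty_of_mem_support hlim hnull hp hV).and
        ((eventually_inter_nonempty_of_mem_support hlim hnull hq hW).and
          ((hε.mono_left hU).eventually_lt_const (lt_add_of_pos_right ε (half_pos hη))))).exists
    have h₁ : D (p, q) - η / 2 < D (x, y) := hVW (mk_mem_prod hxV hyW)
    have h₂ : D (x, y) ≤ εn n := isoDev_le_iff.1 (hSdev n) x hxS y hyS
    have h₃ : D (p, q) ≤ ε + η := by linarith
    exact h₃
  · have h₁ : (π : Measure (ℝ × ℝ)) (π : Measure (ℝ × ℝ)).support = 1 :=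
      (prob_compl_eq_zero_iff Measure.isClosed_support.measurableSet).1
        Measure.measure_compl_support
    simp [measureReal_def, h₁]

end IsoDom

theorem theorem1p6
    {X : Type*} [MetricSpace X] [CompleteSpace X] [TopologicalSpace.SeparableSpace X]
    [MeasurableSpace X] [BorelSpace X] (m : Measure X) [IsProbabilityMeasure m]
    {Xn : ℕ → Type*} [∀ n, MetricSpace (Xn n)] [∀ n, CompleteSpace (Xn n)]
    [∀ n, TopologicalSpace.SeparableSpace (Xn n)]
    [∀ n, MeasurableSpace (Xn n)] [∀ n, BorelSpace (Xn n)]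
    (mn : ∀ n, Measure (Xn n)) [∀ n, IsProbabilityMeasure (mn n)]
    (ν : ProbabilityMeasure ℝ) (νn : ℕ → ProbabilityMeasure ℝ)
    (ε : ℝ) (εn : ℕ → ℝ) (hεn : ∀ n, 0 ≤ εn n)
    (hX : Tendsto (fun n => IsoDom.dConc (mn n) m) atTop (𝓝 0))
    (hν : Tendsto νn atTop (𝓝 ν))
    (hε : Tendsto εn atTop (𝓝 ε))
    (hdom : ∀ n, IsoDom.IsIsoDominant (εn n) (νn n) (mn n)) :
    IsoDom.IsIsoDominant ε ν m := by
  intro μ hμ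
  obtain ⟨μn, hμn, hlim⟩ := IsoDom.exists_tendsto_of_mem_measurement hX hμ
  exact IsoDom.IsoDominates.of_tendsto hν hlim hε fun n => hdom n (μn n) (hμn n)
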